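/- Let $\mathbf k$ be a field. A \emph{variety} is a separated noetherian scheme locally of finite type over $\mathbf k$ (not necessarily reduced), and a \emph{prevariety} is a scheme locally of finite type over $\mathbf k$. A group $G$ has \emph{Property FW} if for every $G$-set $E$ and every subset $A\subset E$ such that $A\smallsetminus g^{-1}A$ is finite for all $g\in G$, there is a $G$-invariant subset $B\subset E$ with $A\,\triangle\, B$ finite. For an irreducible variety $X$, let $\mathrm{Bir}(X)$ be the group of rational maps from $X$ to itself that are represented by an isomorphism over $\mathbf k$ between two dense open subschemes of $X$; the domain $D_\varphi$ of $\varphi\in\mathrm{Bir}(X)$ is the union of the sources of all such isomorphisms representing $\varphi$. For a homomorphism $\rho\colon G\to\mathrm{Bir}(X)$, a \emph{universal globalization} $\hat X=\mathrm{Compl}(G,X)$ is a prevariety with an action of $G$ by $\mathbf k$-automorphisms, containing $X$ as a dense open subscheme that meets every $G$-orbit, such that for every $g\in G$ one has $X\cap g^{-1}X=D_{\rho(g)}$ in $\hat X$, and on this open subset the action of $g$ is an isomorphism onto an open subscheme of $X$ that represents $\rho(g)$. Theorem. Let $G$ be a group with Property FW, $X$ an irreducible variety over $\mathbf k$, and $\rho\colon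 G\to\mathrm{Bir}(X)$ a homomorphism. If $X$ has no embedded points (every dense open subscheme of $X$ is scheme-theoretically dense; for instance if $X$ is reduced), then a universal globalization of $\rho$ exists. For every universal globalization $\hat X$ of $\rho$, there exists a dense $G$-invariant open subset of $\hat X$ that is a variety. -/

import Mathlib

open CategoryTheory AlgebraicGeometry

set_option linter.unusedSectionVars false

universe u

namespace BirAction

noncomputable section

/-! ### Partial maps on `T`-valued points -/

/-- `Graph p a b`: the `T`-valued point `a` of `X` lies in the domain of the partial map `p`, and
`p` maps it to the `T`-valued point `b` of `Y`. -/
def Graph {X Y T : Scheme.{u}} (p : X.PartialMap Y) (a : T ⟶ X) (b : T ⟶ Y) : Prop :=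
  ∃ d : T ⟶ p.domain, d ≫ p.domain.ι = a ∧ d ≫ p.hom = b

theorem Graph.unique {X Y T : Scheme.{u}} {p : X.PartialMap Y} {a : T ⟶ X} {b b' : T ⟶ Y}
    (h : Graph p a b) (h' : Graph p a b') : b = b' := by
  obtain ⟨d, hd, rfl⟩ := h
  obtain ⟨d', hd', rfl⟩ := h'
  rw [(cancel_mono p.domain.ι).1 (hd.trans hd'.symm)]

theorem Graph.precomp {X Y T T' : Scheme.{u}} {p : X.PartialMap Y} {a : T ⟶ X} {b : T ⟶ Y}
    (h : Graph p a b) (c : T' ⟶ T) : Graph p (c ≫ a) (c ≫ b) := by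
  obtain ⟨d, rfl, rfl⟩ := h
  exact ⟨c ≫ d, Category.assoc _ _ _, Category.assoc _ _ _⟩

theorem Graph.mem {X Y T : Scheme.{u}} {p : X.PartialMap Y} {a : T ⟶ X} {b : T ⟶ Y}
    (h : Graph p a b) (t : T) : a t ∈ p.domain := by
  obtain ⟨d, rfl, rfl⟩ := h
  rw [Scheme.Hom.comp_apply]
  exact (d t).2

theorem exists_graph {X Y T : Scheme.{u}} (p : X.PartialMap Y) (a : T ⟶ X)
    (h : ∀ t, a t ∈ p.domain) : ∃ b, Graph p a b := by
  have h' : Set.range a ⊆ Set.range p.domain.ι := by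
    rintro _ ⟨t, rfl⟩
    rw [Scheme.Opens.range_ι]
    exact h t
  exact ⟨_, IsOpenImmersion.lift p.domain.ι a h', IsOpenImmersion.lift_fac _ _ _, rfl⟩

theorem graph_self {X Y : Scheme.{u}} (p : X.PartialMap Y) : Graph p p.domain.ι p.hom :=
  ⟨𝟙 _, Category.id_comp _, Category.id_comp _⟩

theorem graph_id {X T : Scheme.{u}} (a : T ⟶ X) : Graph (Scheme.PartialMap.id X) a a := by
  refine ⟨a ≫ X.topIso.inv, ?_, ?_⟩
  · change (a ≫ X.topIso.inv) ≫ (⊤ : X.Opens).ι = a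
    rw [← Scheme.topIso_hom, Category.assoc, Iso.inv_hom_id, Category.comp_id]
  · change (a ≫ X.topIso.inv) ≫ X.topIso.hom ≫ 𝟙 X = a
    simp

theorem equiv_of_graph {X Y : Scheme.{u}} {p q : X.PartialMap Y} (W : X.Opens)
    (hW : Dense (W : Set X)) {b : W.toScheme ⟶ Y} (hp : Graph p W.ι b) (hq : Graph q W.ι b) :
    p.toRationalMap = q.toRationalMap := by
  have h1 : W ≤ p.domain := fun x hx => by simpa using hp.mem ⟨x, hx⟩
  have h2 : W ≤ q.domain := fun x hx => by simpa using hq.mem ⟨x, hx⟩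
  refine Scheme.PartialMap.toRationalMap_eq_iff.2 ⟨W, hW, h1, h2, ?_⟩
  have e1 : Graph p W.ι (X.homOfLE h1 ≫ p.hom) := ⟨X.homOfLE h1, by simp, rfl⟩
  have e2 : Graph q W.ι (X.homOfLE h2 ≫ q.hom) := ⟨X.homOfLE h2, by simp, rfl⟩
  exact (e1.unique hp).trans (e2.unique hq).symm

theorem exists_graph_of_eq {X Y : Scheme.{u}} {p q : X.PartialMap Y}
    (h : p.toRationalMap = q.toRationalMap) :
    ∃ (W : X.Opens) (_ : Dense (W : Set X)) (b : W.toScheme ⟶ Y),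
      Graph p W.ι b ∧ Graph q W.ι b := by
  obtain ⟨W, hW, h1, h2, e⟩ := Scheme.PartialMap.toRationalMap_eq_iff.1 h
  exact ⟨W, hW, X.homOfLE h1 ≫ p.hom, ⟨X.homOfLE h1, by simp, rfl⟩,
    ⟨X.homOfLE h2, by simp, e.symm⟩⟩

theorem Graph.comp {X Y Z T : Scheme.{u}} [PreirreducibleSpace X] [Nonempty Y]
    {p : X.PartialMap Y} [IsDominant p.hom]
    {q : Y.PartialMap Z} {a : T ⟶ X} {b : T ⟶ Y} {c : T ⟶ Z} (hp : Graph p a b)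
    (hq : Graph q b c) : Graph (p.comp q) a c := by
  obtain ⟨d, rfl, rfl⟩ := hp
  obtain ⟨e, he, rfl⟩ := hq
  have hr : Set.range d ⊆ Set.range (p.hom ⁻¹ᵁ q.domain).ι := by
    rintro _ ⟨t, rfl⟩
    rw [Scheme.Opens.range_ι]
    change p.hom (d t) ∈ q.domain
    rw [← Scheme.Hom.comp_apply, ← he, Scheme.Hom.comp_apply]
    exact (e t).2
  set d' := IsOpenImmersion.lift (p.hom ⁻¹ᵁ q.domain).ι d hr with hd'
  have hd : d' ≫ (p.hom ⁻¹ᵁ q.domain).ι = d := IsOpenImmersion.lift_fac _ _ _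
  have key : d' ≫ p.hom ∣_ q.domain = e := by
    rw [← cancel_mono q.domain.ι, Category.assoc, morphismRestrict_ι, he, ← hd, Category.assoc]
  have h1 : (d' ≫ (p.domain.ι.isoImage (p.hom ⁻¹ᵁ q.domain)).hom) ≫
      (p.domain.ι ''ᵁ (p.hom ⁻¹ᵁ q.domain)).ι = d ≫ p.domain.ι := by
    rw [Category.assoc, Scheme.Hom.isoImage_hom_ι, ← Category.assoc, hd]
  have h2 : (d' ≫ (p.domain.ι.isoImage (p.hom ⁻¹ᵁ q.domain)).hom) ≫
      (p.domain.ι.isoImage (p.hom ⁻¹ᵁ q.domain)).inv ≫ p.hom ∣_ q.domain ≫ q.hom =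
      e ≫ q.hom := by
    rw [Category.assoc, Iso.hom_inv_id_assoc, ← Category.assoc, key]
  exact ⟨_, h1, h2⟩

/-! ### Birational transformations -/

instance isDominant_partialIso {X Y : Scheme.{u}} (f : X.PartialIso Y) :
    IsDominant f.toPartialMap.hom := by
  have := Opens.isDominant_ι f.dense_target
  change IsDominant (f.iso.hom ≫ f.target.ι)
  infer_instance

theorem Graph.symm {X Y T : Scheme.{u}} {f : X.PartialIso Y} {a : T ⟶ X} {b : T ⟶ Y}
    (h : Graph f.toPartialMap a b) : Graph f.symm.toPartialMap b a := by
  obtain ⟨d, rfl, rfl⟩ := h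
  have key : ∀ d : T ⟶ f.source.toScheme,
      (d ≫ f.iso.hom) ≫ f.iso.inv ≫ f.source.ι = d ≫ f.source.ι := fun d => by simp
  exact ⟨d ≫ f.iso.hom, Category.assoc _ _ _, key d⟩

/-- The partial isomorphism given by a dominant open immersion of a dense open subscheme. -/
def ofOpenImmersion {X Y : Scheme.{u}} (W : X.Opens) (hW : Dense (W : Set X))
    (b : W.toScheme ⟶ Y) [IsOpenImmersion b] [IsDominant b] : X.PartialIso Y where
  source := W
  dense_source := hW
  target := b.opensRange
  dense_target := b.denseRange
  iso := b.isoOpensRange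

theorem ofOpenImmersion_toPartialMap {X Y : Scheme.{u}} (p : X.PartialMap Y)
    [IsOpenImmersion p.hom] [IsDominant p.hom] :
    (ofOpenImmersion p.domain p.dense_domain p.hom).toPartialMap = p := by
  obtain ⟨U, hU, b⟩ := p
  exact congrArg (Scheme.PartialMap.mk U hU) (Scheme.Hom.isoOpensRange_hom_ι b)

/-- A birational transformation of an `S`-scheme `X`: a rational map from `X` to itself that is
represented by an isomorphism over `S` between two dense open subschemes of `X`. -/
def Bir (S X : Scheme.{u}) [X.Over S] : Type u :=
  {φ : X.RationalMap X //
    ∃ f : X.PartialIso X, f.IsOver (X ↘ S) (X ↘ S) ∧ f.toRationalMap = φ}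

namespace Bir

variable {S X : Scheme.{u}} [X.Over S]

/-- `f`, an isomorphism over `S` between dense open subschemes of `X`, represents `φ`. -/
def IsRep (φ : Bir S X) (f : X.PartialIso X) : Prop :=
  f.IsOver (X ↘ S) (X ↘ S) ∧ f.toRationalMap = φ.1

theorem exists_isRep (φ : Bir S X) : ∃ f, φ.IsRep f := φ.2

theorem eq_of_isRep {φ ψ : Bir S X} {f : X.PartialIso X} (h : φ.IsRep f) (h' : ψ.IsRep f) :
    φ = ψ := Subtype.ext (h.2.symm.trans h'.2)

theorem IsRep.hom_over {φ : Bir S X} {f : X.PartialIso X} (h : φ.IsRep f) :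
    f.toPartialMap.hom ≫ (X ↘ S) = f.source.ι ≫ (X ↘ S) :=
  (Category.assoc _ _ _).trans h.1

instance (φ : Bir S X) : φ.1.IsDominant := by
  obtain ⟨φ, f, -, rfl⟩ := φ
  exact inferInstanceAs (f.toPartialMap.toRationalMap.IsDominant)

section Group

variable [IrreducibleSpace X]

theorem isOpenImmersion_comp {p q : X.PartialMap X} [IsDominant p.hom] [IsOpenImmersion p.hom]
    [IsOpenImmersion q.hom] : IsOpenImmersion (p.comp q).hom :=
  inferInstanceAs (IsOpenImmersion ((p.domain.ι.isoImage (p.hom ⁻¹ᵁ q.domain)).inv ≫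
    p.hom ∣_ q.domain ≫ q.hom))

theorem comp_over {p q : X.PartialMap X} [IsDominant p.hom]
    (hp : p.hom ≫ (X ↘ S) = p.domain.ι ≫ (X ↘ S)) (hq : q.hom ≫ (X ↘ S) = q.domain.ι ≫ (X ↘ S)) :
    (p.comp q).hom ≫ (X ↘ S) = (p.comp q).domain.ι ≫ (X ↘ S) := by
  have : ((p.domain.ι.isoImage (p.hom ⁻¹ᵁ q.domain)).inv ≫ p.hom ∣_ q.domain ≫ q.hom) ≫ (X ↘ S) =
      (p.domain.ι ''ᵁ (p.hom ⁻¹ᵁ q.domain)).ι ≫ (X ↘ S) := by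
    rw [Category.assoc, Category.assoc, hq, morphismRestrict_ι_assoc, hp,
      Scheme.Hom.isoImage_inv_ι_assoc]
  exact this

theorem comp_isRep {f g : X.PartialIso X} (hf : f.IsOver (X ↘ S) (X ↘ S))
    (hg : g.IsOver (X ↘ S) (X ↘ S)) :
    ∃ h : X.PartialIso X, h.IsOver (X ↘ S) (X ↘ S) ∧
      h.toPartialMap = f.toPartialMap.comp g.toPartialMap := by
  let p := f.toPartialMap.comp g.toPartialMap
  have hf' : f.toPartialMap.hom ≫ (X ↘ S) = f.source.ι ≫ (X ↘ S) := (Category.assoc _ _ _).trans hf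
  have hg' : g.toPartialMap.hom ≫ (X ↘ S) = g.source.ι ≫ (X ↘ S) := (Category.assoc _ _ _).trans hg
  have : IsOpenImmersion f.toPartialMap.hom :=
    inferInstanceAs (IsOpenImmersion (f.iso.hom ≫ f.target.ι))
  have : IsOpenImmersion g.toPartialMap.hom :=
    inferInstanceAs (IsOpenImmersion (g.iso.hom ≫ g.target.ι))
  have : IsOpenImmersion p.hom := isOpenImmersion_comp
  refine ⟨ofOpenImmersion p.domain p.dense_domain p.hom, ?_, ?_⟩
  · have h := comp_over (S := S) hf' hg'
    have h' : p.hom.isoOpensRange.hom ≫ p.hom.opensRange.ι ≫ (X ↘ S) = p.domain.ι ≫ (X ↘ S) := by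
      rw [← Category.assoc, Scheme.Hom.isoOpensRange_hom_ι]
      exact h
    exact h'
  · exact ofOpenImmersion_toPartialMap p

theorem comp_symm {f : X.PartialIso X} :
    f.toRationalMap.comp f.symm.toRationalMap = Scheme.RationalMap.id X := by
  refine (Scheme.RationalMap.toRationalMap_comp _ _).trans ?_
  exact equiv_of_graph f.source f.dense_source
    ((graph_self f.toPartialMap).comp (graph_self f.toPartialMap).symm) (graph_id _)

/-- The product `φ * ψ` is the composition `φ ∘ ψ`. -/
instance : Mul (Bir S X) where
  mul φ ψ := ⟨ψ.1.comp φ.1, by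
    obtain ⟨φ, f, hf, rfl⟩ := φ
    obtain ⟨ψ, g, hg, rfl⟩ := ψ
    obtain ⟨h, hh, e⟩ := comp_isRep hg hf
    exact ⟨h, hh, (congrArg Scheme.PartialMap.toRationalMap e).trans
      (Scheme.RationalMap.toRationalMap_comp _ _).symm⟩⟩

instance : One (Bir S X) where
  one := ⟨Scheme.RationalMap.id X, Scheme.PartialIso.refl X, by
    change 𝟙 _ ≫ (⊤ : X.Opens).ι ≫ _ = _
    exact Category.id_comp _, by
    refine equiv_of_graph ⊤ dense_univ (b := (⊤ : X.Opens).ι) ?_ (graph_id _)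
    exact ⟨𝟙 _, Category.id_comp _, (Category.id_comp _).trans (Category.id_comp _)⟩⟩

instance : Inv (Bir S X) where
  inv φ := ⟨φ.2.choose.symm.toRationalMap, φ.2.choose.symm, φ.2.choose_spec.1.symm, rfl⟩

theorem mul_val (φ ψ : Bir S X) : (φ * ψ).1 = ψ.1.comp φ.1 := rfl

theorem one_val : (1 : Bir S X).1 = Scheme.RationalMap.id X := rfl

instance : Group (Bir S X) :=
  Group.ofLeftAxioms
    (fun a b c => Subtype.ext (by
      simp only [mul_val]
      exact (Scheme.RationalMap.comp_assoc c.1 b.1 a.1).symm))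
    (fun a => Subtype.ext (by rw [mul_val, one_val, Scheme.RationalMap.comp_id]))
    (fun a => Subtype.ext (by
      rw [mul_val, one_val]
      have h := a.2.choose_spec.2
      have : ∀ (b : X.RationalMap X) [b.IsDominant], a.2.choose.toRationalMap = b →
          b.comp a.2.choose.symm.toRationalMap = Scheme.RationalMap.id X := by
        rintro _ _ rfl
        exact comp_symm
      exact this a.1 h))

theorem IsRep.inv {φ : Bir S X} {f : X.PartialIso X} (h : φ.IsRep f) : (φ⁻¹).IsRep f.symm := by
  refine ⟨h.1.symm, ?_⟩
  let ψ : Bir S X := ⟨f.symm.toRationalMap, f.symm, h.1.symm, rfl⟩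
  have : ψ * φ = 1 := by
    refine Subtype.ext ?_
    rw [mul_val, one_val]
    obtain ⟨φ, hφ⟩ := φ
    obtain rfl : f.toRationalMap = φ := h.2
    exact comp_symm
  have h2 : ψ = φ⁻¹ := eq_inv_of_mul_eq_one_left this
  exact congrArg (fun c : Bir S X => c.1) h2

end Group

/-- The maximal domain of definition of `φ` as an isomorphism between open subschemes: the union
of the sources of the partial isomorphisms over `S` representing `φ`. -/
def dom (φ : Bir S X) : X.Opens := sSup {U | ∃ f, φ.IsRep f ∧ f.source = U}

theorem mem_dom {φ : Bir S X} {x : X} : x ∈ φ.dom ↔ ∃ f, φ.IsRep f ∧ x ∈ f.source := by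
  rw [dom, TopologicalSpace.Opens.mem_sSup]
  constructor
  · rintro ⟨_, ⟨f, hf, rfl⟩, hx⟩
    exact ⟨f, hf, hx⟩
  · rintro ⟨f, hf, hx⟩
    exact ⟨_, ⟨f, hf, rfl⟩, hx⟩

theorem dense_dom (φ : Bir S X) : Dense (φ.dom : Set X) := by
  obtain ⟨f, hf⟩ := φ.exists_isRep
  exact f.dense_source.mono fun x hx => mem_dom.2 ⟨f, hf, hx⟩

end Bir

/-- `X` has no embedded points: every dense open subscheme is scheme-theoretically dense. -/
class NoEmbeddedPoints (X : Scheme.{u}) : Prop where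
  isSchemeTheoreticallyDominant (U : X.Opens) (hU : Dense (U : Set X)) :
    IsSchemeTheoreticallyDominant U.ι

section Ext

variable {S X : Scheme.{u}} [X.Over S]

theorem ext_of_isSchemeTheoreticallyDominant {U W Y Z : Scheme.{u}} {a b : W ⟶ Y} (s : Y ⟶ Z)
    [IsSeparated s] (h : a ≫ s = b ≫ s) (i : U ⟶ W) [IsSchemeTheoreticallyDominant i]
    (hi : i ≫ a = i ≫ b) : a = b := by
  let l := Limits.pullback.lift a b h
  let e := Limits.pullback.fst l (Limits.pullback.diagonal s)
  have h1 : e ≫ a = Limits.pullback.snd l (Limits.pullback.diagonal s) := by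
    have := Limits.pullback.condition (f := l) (g := Limits.pullback.diagonal s) =≫
      Limits.pullback.fst s s
    rw [Category.assoc, Category.assoc, Limits.pullback.lift_fst, Limits.pullback.diagonal_fst,
      Category.comp_id] at this
    exact this
  have h2 : e ≫ b = Limits.pullback.snd l (Limits.pullback.diagonal s) := by
    have := Limits.pullback.condition (f := l) (g := Limits.pullback.diagonal s) =≫
      Limits.pullback.snd s s
    rw [Category.assoc, Category.assoc, Limits.pullback.lift_snd, Limits.pullback.diagonal_snd,
      Category.comp_id] at this
    exact this
  let i' : U ⟶ Limits.pullback l (Limits.pullback.diagonal s) :=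
    Limits.pullback.lift i (i ≫ a) (by
      apply Limits.pullback.hom_ext
      · rw [Category.assoc, Category.assoc, Limits.pullback.lift_fst,
          Limits.pullback.diagonal_fst, Category.comp_id]
      · rw [Category.assoc, Category.assoc, Limits.pullback.lift_snd,
          Limits.pullback.diagonal_snd, Category.comp_id, hi])
  have hi' : i' ≫ e = i := Limits.pullback.lift_fst _ _ _
  have : IsIso e := by
    rw [IsClosedImmersion.isIso_iff_ker_eq_bot]
    refine le_bot_iff.1 ((Scheme.Hom.le_ker_comp i' e).trans ?_)
    rw [hi', i.ker_eq_bot]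
  rw [← cancel_epi e, h1, h2]

variable [IsLocallyNoetherian X] [NoEmbeddedPoints X] [IsSeparated (X ↘ S)]

theorem Graph.unique_of_eq {T : Scheme.{u}} {p q : X.PartialMap X}
    (hp : p.hom ≫ (X ↘ S) = p.domain.ι ≫ (X ↘ S)) (hq : q.hom ≫ (X ↘ S) = q.domain.ι ≫ (X ↘ S))
    (h : p.toRationalMap = q.toRationalMap)
    {a : T ⟶ X} {b b' : T ⟶ X} (ha : Graph p a b) (hb : Graph q a b') : b = b' := by
  obtain ⟨W, hW, c, hc, hc'⟩ := exists_graph_of_eq h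
  let V := p.domain ⊓ q.domain
  have hr : Set.range a ⊆ Set.range V.ι := by
    rintro _ ⟨t, rfl⟩
    rw [Scheme.Opens.range_ι]
    exact ⟨ha.mem t, hb.mem t⟩
  obtain ⟨d, rfl⟩ : ∃ d, d ≫ V.ι = a := ⟨_, IsOpenImmersion.lift_fac V.ι a hr⟩
  have g1 : Graph p V.ι (X.homOfLE inf_le_left ≫ p.hom) := ⟨X.homOfLE inf_le_left, by simp, rfl⟩
  have g2 : Graph q V.ι (X.homOfLE inf_le_right ≫ q.hom) := ⟨X.homOfLE inf_le_right, by simp, rfl⟩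
  rw [ha.unique (g1.precomp d), hb.unique (g2.precomp d)]
  congr 1
  have := NoEmbeddedPoints.isSchemeTheoreticallyDominant W hW
  have : IsSchemeTheoreticallyDominant (X.homOfLE (inf_le_right : W ⊓ V ≤ V)) :=
    .of_isPullback (isPullback_opens_inf W V)
  refine ext_of_isSchemeTheoreticallyDominant (X ↘ S) ?_
    (X.homOfLE (inf_le_right : W ⊓ V ≤ V)) ?_
  · simp only [Category.assoc, hp, hq, Scheme.homOfLE_ι_assoc]
  · have k1 := g1.precomp (X.homOfLE (inf_le_right : W ⊓ V ≤ V))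
    have k2 := g2.precomp (X.homOfLE (inf_le_right : W ⊓ V ≤ V))
    have k3 := hc.precomp (X.homOfLE (inf_le_left : W ⊓ V ≤ W))
    have k4 := hc'.precomp (X.homOfLE (inf_le_left : W ⊓ V ≤ W))
    rw [Scheme.homOfLE_ι] at k1 k2 k3 k4
    exact (k1.unique k3).trans (k4.unique k2)

end Ext

namespace Bir

section Max

variable {S X : Scheme.{u}} [X.Over S] [IsLocallyNoetherian X] [NoEmbeddedPoints X]
  [IsSeparated (X ↘ S)]

theorem IsRep.graph_unique {T : Scheme.{u}} {φ : Bir S X} {f g : X.PartialIso X} (hf : φ.IsRep f)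
    (hg : φ.IsRep g) {a b b' : T ⟶ X} (ha : Graph f.toPartialMap a b)
    (hb : Graph g.toPartialMap a b') : b = b' :=
  Graph.unique_of_eq (S := S) hf.hom_over hg.hom_over (hf.2.trans hg.2.symm) ha hb

theorem source_le_dom {φ : Bir S X} {f : X.PartialIso X} (hf : φ.IsRep f) : f.source ≤ φ.dom :=
  fun _ hx => mem_dom.2 ⟨f, hf, hx⟩

/-- The open cover of `φ.dom` by the sources of the representatives of `φ`. -/
def domCover (φ : Bir S X) : φ.dom.toScheme.OpenCover where
  I₀ := {f : X.PartialIso X // φ.IsRep f}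
  X f := f.1.source
  f f := X.homOfLE (source_le_dom f.2)
  mem₀ := by
    rw [Scheme.presieve₀_mem_precoverage_iff]
    refine ⟨fun x => ?_, inferInstance⟩
    obtain ⟨f, hf, hx⟩ := mem_dom.1 x.2
    exact ⟨⟨f, hf⟩, ⟨x.1, hx⟩, Subtype.ext (by simp)⟩

theorem domCover_ι (φ : Bir S X) (f : {f : X.PartialIso X // φ.IsRep f}) :
    φ.domCover.f f ≫ φ.dom.ι = f.1.source.ι := X.homOfLE_ι (source_le_dom f.2)

theorem pullback_domCover (φ : Bir S X) (f g : {f : X.PartialIso X // φ.IsRep f}) :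
    Limits.pullback.fst (φ.domCover.f f) (φ.domCover.f g) ≫ f.1.toPartialMap.hom =
      Limits.pullback.snd (φ.domCover.f f) (φ.domCover.f g) ≫ g.1.toPartialMap.hom := by
  have e : Limits.pullback.fst (φ.domCover.f f) (φ.domCover.f g) ≫ f.1.source.ι =
      Limits.pullback.snd (φ.domCover.f f) (φ.domCover.f g) ≫ g.1.source.ι := by
    have h := Limits.pullback.condition (f := φ.domCover.f f) (g := φ.domCover.f g) =≫ φ.dom.ι
    rw [Category.assoc, Category.assoc, domCover_ι, domCover_ι] at h
    exact h
  have h1 : Graph f.1.toPartialMap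
      (Limits.pullback.fst (φ.domCover.f f) (φ.domCover.f g) ≫ f.1.source.ι)
      (Limits.pullback.fst (φ.domCover.f f) (φ.domCover.f g) ≫ f.1.toPartialMap.hom) :=
    (graph_self f.1.toPartialMap).precomp _
  have h2 : Graph g.1.toPartialMap
      (Limits.pullback.snd (φ.domCover.f f) (φ.domCover.f g) ≫ g.1.source.ι)
      (Limits.pullback.snd (φ.domCover.f f) (φ.domCover.f g) ≫ g.1.toPartialMap.hom) :=
    (graph_self g.1.toPartialMap).precomp _
  exact f.2.graph_unique g.2 h1 (e ▸ h2)

theorem exists_maxMap (φ : Bir S X) : ∃ m : φ.dom.toScheme ⟶ X,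
    ∀ f : {f : X.PartialIso X // φ.IsRep f}, φ.domCover.f f ≫ m = f.1.toPartialMap.hom :=
  ⟨φ.domCover.glueMorphisms (fun f => f.1.toPartialMap.hom) φ.pullback_domCover,
    φ.domCover.ι_glueMorphisms _ _⟩

/-- The morphism defined by `φ` on its maximal domain. -/
def maxMap (φ : Bir S X) : X.PartialMap X where
  domain := φ.dom
  dense_domain := φ.dense_dom
  hom := φ.exists_maxMap.choose

theorem domCover_maxMap (φ : Bir S X) (f : {f : X.PartialIso X // φ.IsRep f}) :
    φ.domCover.f f ≫ φ.maxMap.hom = f.1.toPartialMap.hom :=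
  φ.exists_maxMap.choose_spec f

theorem IsRep.graph_maxMap {T : Scheme.{u}} {φ : Bir S X} {f : X.PartialIso X} (hf : φ.IsRep f)
    {a b : T ⟶ X} (h : Graph f.toPartialMap a b) : Graph φ.maxMap a b := by
  obtain ⟨d, rfl, rfl⟩ := h
  have key : Graph φ.maxMap f.source.ι f.toPartialMap.hom :=
    ⟨φ.domCover.f ⟨f, hf⟩, φ.domCover_ι ⟨f, hf⟩, φ.domCover_maxMap ⟨f, hf⟩⟩
  exact key.precomp d

theorem exists_graph_of_maxMap {T : Scheme.{u}} {φ : Bir S X} {a b : T ⟶ X}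
    (h : Graph φ.maxMap a b) (t : T) : ∃ (f : X.PartialIso X) (U : T.Opens), φ.IsRep f ∧ t ∈ U ∧
      Graph f.toPartialMap (U.ι ≫ a) (U.ι ≫ b) := by
  obtain ⟨f, hf, hx⟩ := mem_dom.1 (h.mem t)
  refine ⟨f, a ⁻¹ᵁ f.source, hf, hx, ?_⟩
  obtain ⟨c, hc⟩ := exists_graph f.toPartialMap ((a ⁻¹ᵁ f.source).ι ≫ a) (fun t => by
    rw [Scheme.Hom.comp_apply]
    exact t.2)
  rwa [(h.precomp (a ⁻¹ᵁ f.source).ι).unique (hf.graph_maxMap hc)]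

theorem maxMap_over (φ : Bir S X) : φ.maxMap.hom ≫ (X ↘ S) = φ.dom.ι ≫ (X ↘ S) := by
  have key : ∀ f : {f : X.PartialIso X // φ.IsRep f},
      φ.domCover.f f ≫ φ.maxMap.hom ≫ (X ↘ S) = φ.domCover.f f ≫ φ.dom.ι ≫ (X ↘ S) := fun f =>
    (Category.assoc _ _ _).symm.trans <| (congrArg (· ≫ (X ↘ S)) (φ.domCover_maxMap f)).trans <|
      f.2.hom_over.trans <| (congrArg (· ≫ (X ↘ S)) (φ.domCover_ι f)).symm.trans
        (Category.assoc _ _ _)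
  exact φ.domCover.hom_ext _ _ key

variable [IrreducibleSpace X]

theorem graph_maxMap_symm {T : Scheme.{u}} {φ ψ : Bir S X} (e : ψ = φ⁻¹) {a b : T ⟶ X}
    (h : Graph φ.maxMap a b) : Graph ψ.maxMap b a := by
  subst e
  obtain ⟨c, hc⟩ := exists_graph (φ⁻¹).maxMap b (fun t => by
    obtain ⟨f, U, hf, ht, hg⟩ := exists_graph_of_maxMap h t
    exact (hf.inv.graph_maxMap hg.symm).mem ⟨t, ht⟩)
  suffices c = a by rwa [← this]
  refine Scheme.hom_ext_of_forall _ _ fun t => ?_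
  obtain ⟨f, U, hf, ht, hg⟩ := exists_graph_of_maxMap h t
  exact ⟨U, ht, (hc.precomp U.ι).unique (hf.inv.graph_maxMap hg.symm)⟩

theorem graph_maxMap_one {T : Scheme.{u}} {φ : Bir S X} (e : φ = 1) (a : T ⟶ X) :
    Graph φ.maxMap a a := by
  subst e
  have h : (1 : Bir S X).IsRep (Scheme.PartialIso.refl X) := by
    refine ⟨?_, ?_⟩
    · change 𝟙 _ ≫ (⊤ : X.Opens).ι ≫ _ = _
      exact Category.id_comp _
    · refine equiv_of_graph ⊤ dense_univ (b := (⊤ : X.Opens).ι) ?_ (graph_id _)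
      exact ⟨𝟙 _, Category.id_comp _, (Category.id_comp _).trans (Category.id_comp _)⟩
  refine h.graph_maxMap ?_
  have h1 : (a ≫ X.topIso.inv) ≫ (⊤ : X.Opens).ι = a := by
    rw [← Scheme.topIso_hom, Category.assoc, Iso.inv_hom_id, Category.comp_id]
  exact ⟨a ≫ X.topIso.inv, h1, (congrArg (_ ≫ ·) (Category.id_comp _)).trans h1⟩

/-- The isomorphism defined by `φ` between its maximal domain and that of its inverse. -/
def maxHom (φ ψ : Bir S X) (e : ψ = φ⁻¹) : φ.dom.toScheme ⟶ ψ.dom.toScheme :=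
  (graph_maxMap_symm e (graph_self φ.maxMap)).choose

theorem maxHom_ι (φ ψ : Bir S X) (e : ψ = φ⁻¹) : maxHom φ ψ e ≫ ψ.dom.ι = φ.maxMap.hom :=
  (graph_maxMap_symm e (graph_self φ.maxMap)).choose_spec.1

theorem maxHom_maxHom (φ ψ : Bir S X) (e : ψ = φ⁻¹) (e' : φ = ψ⁻¹) :
    maxHom φ ψ e ≫ maxHom ψ φ e' = 𝟙 _ := by
  rw [← cancel_mono φ.dom.ι, Category.assoc, maxHom_ι, Category.id_comp]
  exact (graph_maxMap_symm e (graph_self φ.maxMap)).choose_spec.2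

/-- `φ` as an isomorphism between its maximal domain and that of its inverse. -/
def maxIso (φ : Bir S X) : X.PartialIso X where
  source := φ.dom
  dense_source := φ.dense_dom
  target := (φ⁻¹).dom
  dense_target := (φ⁻¹).dense_dom
  iso := ⟨maxHom φ φ⁻¹ rfl, maxHom φ⁻¹ φ (inv_inv φ).symm, maxHom_maxHom _ _ _ _, maxHom_maxHom _ _ _ _⟩

theorem maxIso_toPartialMap (φ : Bir S X) : φ.maxIso.toPartialMap = φ.maxMap :=
  congrArg (Scheme.PartialMap.mk φ.dom φ.dense_dom) (maxHom_ι φ φ⁻¹ rfl)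

theorem isRep_maxIso (φ : Bir S X) : φ.IsRep φ.maxIso := by
  constructor
  · refine (Category.assoc _ _ _).symm.trans ?_
    exact (congrArg (· ≫ (X ↘ S)) (maxHom_ι φ φ⁻¹ rfl)).trans φ.maxMap_over
  · obtain ⟨f, hf⟩ := φ.exists_isRep
    refine (congrArg Scheme.PartialMap.toRationalMap φ.maxIso_toPartialMap).trans ?_
    refine Eq.trans ?_ hf.2
    exact equiv_of_graph f.source f.dense_source (hf.graph_maxMap (graph_self f.toPartialMap))
      (graph_self f.toPartialMap)

theorem graph_maxMap_mul {T : Scheme.{u}} {φ ψ χ : Bir S X} (e : χ = φ * ψ) {a b c : T ⟶ X}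
    (h : Graph ψ.maxMap a b) (h' : Graph φ.maxMap b c) : Graph χ.maxMap a c := by
  subst e
  obtain ⟨m, hm, hm'⟩ := comp_isRep ψ.isRep_maxIso.1 φ.isRep_maxIso.1
  have key : (φ * ψ).IsRep m := by
    refine ⟨hm, (congrArg Scheme.PartialMap.toRationalMap hm').trans ?_⟩
    refine (Scheme.RationalMap.toRationalMap_comp _ _).symm.trans ?_
    have : ∀ (p q p' q' : X.RationalMap X) [p.IsDominant] [q.IsDominant]
        [p'.IsDominant] [q'.IsDominant], p = p' → q = q' → p.comp q = p'.comp q' := by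
      rintro p q _ _ _ _ _ _ rfl rfl
      rfl
    exact this _ _ ψ.1 φ.1 ψ.isRep_maxIso.2 φ.isRep_maxIso.2
  refine key.graph_maxMap ?_
  rw [hm']
  refine Graph.comp (b := b) ?_ ?_
  · rwa [maxIso_toPartialMap]
  · rwa [maxIso_toPartialMap]

end Max

end Bir

/-! ### The universal globalization -/

/-- A universal globalization of the birational action `ρ` of `G` on the `S`-scheme `X`: an
`S`-scheme, locally of finite type, with an action of `G` by automorphisms over `S`, that contains
`X` as a dense open subscheme, such that `X` meets every `G`-orbit and such that the partial action
of `G` on `X` obtained by restriction is the one given by `ρ`. -/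
structure UniversalGlobalization {S X : Scheme.{u}} [X.Over S] [IrreducibleSpace X] {G : Type u}
    [Group G] (ρ : G →* Bir S X) where
  /-- The underlying scheme. -/
  space : Scheme.{u}
  /-- The structure morphism. -/
  str : space ⟶ S
  locallyOfFiniteType : LocallyOfFiniteType str
  /-- The action; in `Aut`, the product `g * h` is "`h` followed by `g`", so this is a left
  action. -/
  act : G →* Aut space
  act_str (g : G) : (act g).hom ≫ str = str
  /-- The inclusion of `X`. -/
  incl : X ⟶ space
  isOpenImmersion : IsOpenImmersion incl
  incl_str : incl ≫ str = X ↘ S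
  denseRange : DenseRange incl
  /-- `X` meets every orbit. -/
  exists_act_incl (z : space) : ∃ (g : G) (x : X), (act g).hom (incl x) = z
  /-- The partial action obtained by restriction to `X` is the given one: `g` maps a point `x` of
  `X` into `X` exactly when `x` is in the maximal domain of `ρ g`, and on this domain the action of
  `g` is a representative of `ρ g`. -/
  restrict (g : G) : ∃ f : X.PartialIso X, (ρ g).IsRep f ∧ f.source = (ρ g).dom ∧
    (∀ x : X, (act g).hom (incl x) ∈ Set.range incl ↔ x ∈ f.source) ∧
    f.source.ι ≫ incl ≫ (act g).hom = f.iso.hom ≫ f.target.ι ≫ incl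

section Construction

variable {S X : Scheme.{u}} [X.Over S] [IsLocallyNoetherian X] [NoEmbeddedPoints X]
  [IsSeparated (X ↘ S)] [IrreducibleSpace X] {G : Type u} [Group G] (ρ : G →* Bir S X)

/-- The transition relation: `a` in the chart `i • X` and `b` in the chart `j • X` are the same
point. -/
def Rel {T : Scheme.{u}} (i j : G) (a b : T ⟶ X) : Prop := Graph (ρ (j⁻¹ * i)).maxMap a b

variable {ρ}

theorem Rel.symm {T : Scheme.{u}} {i j : G} {a b : T ⟶ X} (h : Rel ρ i j a b) : Rel ρ j i b a :=
  Bir.graph_maxMap_symm (by rw [← map_inv]; congr 1; group) h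

theorem Rel.trans {T : Scheme.{u}} {i j k : G} {a b c : T ⟶ X} (h : Rel ρ i j a b)
    (h' : Rel ρ j k b c) : Rel ρ i k a c :=
  Bir.graph_maxMap_mul (by rw [← map_mul]; congr 1; group) h h'

variable (ρ) in
theorem Rel.refl {T : Scheme.{u}} (i : G) (a : T ⟶ X) : Rel ρ i i a a :=
  Bir.graph_maxMap_one (by simp) a

theorem Rel.unique {T : Scheme.{u}} {i j : G} {a b b' : T ⟶ X} (h : Rel ρ i j a b)
    (h' : Rel ρ i j a b') : b = b' := Graph.unique h h'

theorem Rel.precomp {T T' : Scheme.{u}} {i j : G} {a b : T ⟶ X} (h : Rel ρ i j a b) (c : T' ⟶ T) :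
    Rel ρ i j (c ≫ a) (c ≫ b) := Graph.precomp h c

variable (ρ)

/-- The open subset of the chart `i` along which it is glued to the chart `j`. -/
def glueOpen (i j : G) : X.Opens := (ρ (j⁻¹ * i)).dom

/-- The gluing morphism, with values in the chart `j`. -/
def glueMap (i j : G) : (glueOpen ρ i j).toScheme ⟶ X := (ρ (j⁻¹ * i)).maxMap.hom

theorem rel_glueMap (i j : G) : Rel ρ i j (glueOpen ρ i j).ι (glueMap ρ i j) := graph_self _

variable {ρ} in
theorem Rel.exists_lift {T : Scheme.{u}} {i j : G} {a b : T ⟶ X} (h : Rel ρ i j a b) :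
    ∃ d : T ⟶ glueOpen ρ i j, d ≫ (glueOpen ρ i j).ι = a ∧ d ≫ glueMap ρ i j = b := h

/-- The transition morphism. -/
def glueT (i j : G) : (glueOpen ρ i j).toScheme ⟶ (glueOpen ρ j i).toScheme :=
  (rel_glueMap ρ i j).symm.exists_lift.choose

theorem glueT_ι (i j : G) : glueT ρ i j ≫ (glueOpen ρ j i).ι = glueMap ρ i j :=
  (rel_glueMap ρ i j).symm.exists_lift.choose_spec.1

theorem isIso_glueOpen_ι (i : G) : IsIso (glueOpen ρ i i).ι := by
  obtain ⟨d, hd, -⟩ := (Rel.refl ρ i (𝟙 X)).exists_lift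
  have : IsSplitEpi (glueOpen ρ i i).ι := ⟨⟨⟨d, hd⟩⟩⟩
  exact isIso_of_mono_of_isSplitEpi _

theorem glueT_id (i : G) : glueT ρ i i = 𝟙 _ := by
  rw [← cancel_mono (glueOpen ρ i i).ι, glueT_ι, Category.id_comp]
  exact (rel_glueMap ρ i i).unique (Rel.refl ρ i _)

/-- The triple intersection. -/
abbrev glueP (i j k : G) : Scheme.{u} := Limits.pullback (glueOpen ρ i j).ι (glueOpen ρ i k).ι

theorem rel_glueP (i j k : G) : Rel ρ j k
    (Limits.pullback.fst (glueOpen ρ i j).ι (glueOpen ρ i k).ι ≫ glueMap ρ i j)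
    (Limits.pullback.snd (glueOpen ρ i j).ι (glueOpen ρ i k).ι ≫ glueMap ρ i k) := by
  have h1 := (rel_glueMap ρ i j).precomp
    (Limits.pullback.fst (glueOpen ρ i j).ι (glueOpen ρ i k).ι)
  have h2 := (rel_glueMap ρ i k).precomp
    (Limits.pullback.snd (glueOpen ρ i j).ι (glueOpen ρ i k).ι)
  rw [← Limits.pullback.condition] at h2
  exact h1.symm.trans h2

/-- The transition morphism on triple intersections. -/
def glueT' (i j k : G) : glueP ρ i j k ⟶ glueP ρ j k i :=
  Limits.pullback.lift (rel_glueP ρ i j k).exists_lift.choose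
    (Limits.pullback.fst _ _ ≫ glueT ρ i j) (by
      rw [(rel_glueP ρ i j k).exists_lift.choose_spec.1, Category.assoc, glueT_ι])

theorem glueT'_snd (i j k : G) : glueT' ρ i j k ≫ Limits.pullback.snd _ _ =
    Limits.pullback.fst _ _ ≫ glueT ρ i j := Limits.pullback.lift_snd _ _ _

theorem glueT'_fst_ι (i j k : G) :
    glueT' ρ i j k ≫ Limits.pullback.fst _ _ ≫ (glueOpen ρ j k).ι =
      Limits.pullback.fst _ _ ≫ glueMap ρ i j := by
  rw [← Category.assoc, glueT', Limits.pullback.lift_fst]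
  exact (rel_glueP ρ i j k).exists_lift.choose_spec.1

theorem glueT'_fst_map (i j k : G) :
    glueT' ρ i j k ≫ Limits.pullback.fst _ _ ≫ glueMap ρ j k =
      Limits.pullback.snd _ _ ≫ glueMap ρ i k := by
  rw [← Category.assoc, glueT', Limits.pullback.lift_fst]
  exact (rel_glueP ρ i j k).exists_lift.choose_spec.2

theorem glueT'_cocycle (i j k : G) :
    glueT' ρ i j k ≫ glueT' ρ j k i ≫ glueT' ρ k i j = 𝟙 _ := by
  have key : (glueT' ρ i j k ≫ glueT' ρ j k i ≫ glueT' ρ k i j) ≫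
      Limits.pullback.fst _ _ ≫ (glueOpen ρ i j).ι =
      Limits.pullback.fst _ _ ≫ (glueOpen ρ i j).ι := by
    simp only [Category.assoc, glueT'_fst_ι, glueT'_fst_map]
    have h1 := ((rel_glueP ρ j k i).precomp (glueT' ρ i j k))
    rw [glueT'_fst_map] at h1
    have h2 := ((rel_glueMap ρ i k).precomp
      (Limits.pullback.snd (glueOpen ρ i j).ι (glueOpen ρ i k).ι)).symm
    rw [← Limits.pullback.condition] at h2
    exact h1.unique h2
  apply Limits.pullback.hom_ext
  · rw [← cancel_mono (glueOpen ρ i j).ι, Category.assoc, key, Category.id_comp]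
  · rw [← cancel_mono (glueOpen ρ i k).ι, Category.assoc, ← Limits.pullback.condition, key,
      Category.id_comp, Limits.pullback.condition]

/-- The gluing data: copies of `X` indexed by `G`, the copies `i` and `j` being glued by the
maximal isomorphism defined by `j⁻¹ * i`. -/
def glueData : Scheme.GlueData.{u} where
  J := G
  U _ := X
  V p := (glueOpen ρ p.1 p.2).toScheme
  f i j := (glueOpen ρ i j).ι
  f_id i := isIso_glueOpen_ι ρ i
  t i j := glueT ρ i j
  t_id i := glueT_id ρ i
  t' i j k := glueT' ρ i j k
  t_fac i j k := glueT'_snd ρ i j k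
  cocycle i j k := glueT'_cocycle ρ i j k
  f_open _ _ := inferInstance

/-- The underlying scheme of the universal globalization. -/
def glued : Scheme.{u} := (glueData ρ).glued

/-- The chart `i • X`. -/
def chart (i : G) : X ⟶ glued ρ := (glueData ρ).ι i

instance (i : G) : IsOpenImmersion (chart ρ i) := (glueData ρ).ι_isOpenImmersion i

variable {ρ} in
theorem Rel.chart_eq {T : Scheme.{u}} {i j : G} {a b : T ⟶ X} (h : Rel ρ i j a b) :
    a ≫ chart ρ i = b ≫ chart ρ j := by
  have h0 : glueT ρ i j ≫ (glueOpen ρ j i).ι ≫ chart ρ j = (glueOpen ρ i j).ι ≫ chart ρ i :=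
    (glueData ρ).glue_condition i j
  obtain ⟨d, rfl, rfl⟩ := h.exists_lift
  have h1 : (glueOpen ρ i j).ι ≫ chart ρ i = glueMap ρ i j ≫ chart ρ j := by
    rw [← h0, ← Category.assoc, glueT_ι]
  rw [Category.assoc, h1, Category.assoc]

theorem exists_chart (z : glued ρ) : ∃ (i : G) (x : X), chart ρ i x = z :=
  (glueData ρ).ι_jointly_surjective z

theorem chart_mem_range {i j : G} {x : X} :
    chart ρ i x ∈ Set.range (chart ρ j) ↔ x ∈ glueOpen ρ i j := by
  constructor
  · rintro ⟨y, hy⟩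
    obtain ⟨v, hv, -⟩ := ((glueData ρ).ι_eq_iff i j x y).1 hy.symm
    have h : (glueOpen ρ i j).ι v = x := hv
    rw [← h]
    exact v.2
  · intro hx
    have h := congr($((rel_glueMap ρ i j).chart_eq) ⟨x, hx⟩)
    exact ⟨glueMap ρ i j ⟨x, hx⟩, h.symm⟩

theorem glued_hom_ext {Y : Scheme.{u}} {a b : glued ρ ⟶ Y}
    (h : ∀ i, chart ρ i ≫ a = chart ρ i ≫ b) : a = b :=
  (glueData ρ).openCover.hom_ext _ _ h

theorem exists_desc {Y : Scheme.{u}} (m : G → (X ⟶ Y))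
    (h : ∀ i j, (glueOpen ρ i j).ι ≫ m i = glueMap ρ i j ≫ m j) :
    ∃ a : glued ρ ⟶ Y, ∀ i, chart ρ i ≫ a = m i :=
  have h2 : ∀ i j : G,
      (glueOpen ρ i j).ι ≫ m i = (glueT ρ i j ≫ (glueOpen ρ j i).ι) ≫ m j := fun i j => by
    rw [glueT_ι, h]
  ⟨Limits.Multicoequalizer.desc (glueData ρ).toGlueData.diagram Y m (fun p => h2 p.1 p.2),
    fun i => Limits.Multicoequalizer.π_desc _ _ _ _ _⟩

theorem exists_actHom (g : G) : ∃ a : glued ρ ⟶ glued ρ, ∀ i, chart ρ i ≫ a = chart ρ (g * i) :=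
  exists_desc ρ (fun i => chart ρ (g * i)) fun i j => by
    have h : Rel ρ (g * i) (g * j) (glueOpen ρ i j).ι (glueMap ρ i j) := by
      have := rel_glueMap ρ i j
      unfold Rel at this ⊢
      rwa [show (g * j)⁻¹ * (g * i) = j⁻¹ * i by group]
    exact h.chart_eq

/-- The translation by `g`. -/
def actHom (g : G) : glued ρ ⟶ glued ρ := (exists_actHom ρ g).choose

theorem chart_actHom (g i : G) : chart ρ i ≫ actHom ρ g = chart ρ (g * i) :=
  (exists_actHom ρ g).choose_spec i

theorem actHom_one : actHom ρ 1 = 𝟙 _ :=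
  glued_hom_ext ρ fun i => by rw [chart_actHom, one_mul, Category.comp_id]

theorem actHom_comp (g h : G) : actHom ρ h ≫ actHom ρ g = actHom ρ (g * h) :=
  glued_hom_ext ρ fun i => by
    rw [← Category.assoc, chart_actHom, chart_actHom, chart_actHom, mul_assoc]

/-- The action of `G` on the glued scheme. -/
def glueAct : G →* Aut (glued ρ) where
  toFun g := ⟨actHom ρ g, actHom ρ g⁻¹, by rw [actHom_comp, inv_mul_cancel, actHom_one],
    by rw [actHom_comp, mul_inv_cancel, actHom_one]⟩
  map_one' := Aut.ext (actHom_one ρ)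
  map_mul' g h := Aut.ext (actHom_comp ρ g h).symm

theorem exists_gluedStr : ∃ a : glued ρ ⟶ S, ∀ i, chart ρ i ≫ a = X ↘ S :=
  exists_desc ρ (fun _ => X ↘ S) fun i j => (Bir.maxMap_over (ρ (j⁻¹ * i))).symm

/-- The structure morphism of the glued scheme. -/
def gluedStr : glued ρ ⟶ S := (exists_gluedStr ρ).choose

theorem chart_gluedStr (i : G) : chart ρ i ≫ gluedStr ρ = X ↘ S := (exists_gluedStr ρ).choose_spec i

theorem locallyOfFiniteType_gluedStr [LocallyOfFiniteType (X ↘ S)] :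
    LocallyOfFiniteType (gluedStr ρ) := by
  have : IsZariskiLocalAtSource @LocallyOfFiniteType.{u} :=
    HasRingHomProperty.instIsZariskiLocalAtSource (Q := RingHom.FiniteType)
  refine IsZariskiLocalAtSource.of_openCover (P := @LocallyOfFiniteType.{u})
    (glueData ρ).openCover fun i => ?_
  have h' : LocallyOfFiniteType (chart ρ i ≫ gluedStr ρ) := by
    rw [chart_gluedStr ρ i]
    infer_instance
  exact h'

/-- The universal globalization `Compl(G, X)`. -/
def compl [LocallyOfFiniteType (X ↘ S)] : UniversalGlobalization ρ where
  space := glued ρ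
  str := gluedStr ρ
  locallyOfFiniteType := locallyOfFiniteType_gluedStr ρ
  act := glueAct ρ
  act_str g := glued_hom_ext ρ fun i => by
    refine (Category.assoc _ _ _).symm.trans ?_
    refine (congrArg (· ≫ gluedStr ρ) (chart_actHom ρ g i)).trans ?_
    exact (chart_gluedStr ρ _).trans (chart_gluedStr ρ _).symm
  incl := chart ρ 1
  isOpenImmersion := inferInstance
  incl_str := chart_gluedStr ρ 1
  denseRange := by
    refine dense_iff_inter_open.2 fun U hU ⟨z, hz⟩ => ?_
    obtain ⟨i, x, rfl⟩ := exists_chart ρ z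
    obtain ⟨y, hy, hy'⟩ := dense_iff_inter_open.1 (Bir.dense_dom (ρ (1⁻¹ * i)))
      (chart ρ i ⁻¹' U) (hU.preimage (chart ρ i).continuous) ⟨x, hz⟩
    exact ⟨chart ρ i y, hy, (chart_mem_range ρ).2 hy'⟩
  exists_act_incl z := by
    obtain ⟨i, x, rfl⟩ := exists_chart ρ z
    refine ⟨i, x, ?_⟩
    have := congr($(chart_actHom ρ i 1) x)
    rw [mul_one, Scheme.Hom.comp_apply] at this
    exact this
  restrict g := by
    refine ⟨(ρ g).maxIso, (ρ g).isRep_maxIso, rfl, fun x => ?_, ?_⟩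
    · have := congr($(chart_actHom ρ g 1) x)
      rw [mul_one, Scheme.Hom.comp_apply] at this
      have h2 : (chart ρ g x ∈ Set.range (chart ρ 1)) ↔ x ∈ (ρ (1⁻¹ * g)).dom :=
        chart_mem_range ρ
      rw [inv_one, one_mul] at h2
      exact (iff_of_eq (congrArg (· ∈ Set.range (chart ρ 1)) this)).trans h2
    · have h : Rel ρ g 1 (ρ g).maxMap.domain.ι (ρ g).maxMap.hom := by
        unfold Rel
        rw [inv_one, one_mul]
        exact graph_self _
      have h1 : (ρ g).dom.ι ≫ chart ρ 1 ≫ actHom ρ g = (ρ g).dom.ι ≫ chart ρ g := by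
        rw [chart_actHom, mul_one]
      refine h1.trans (h.chart_eq.trans ?_)
      refine Eq.trans ?_ (Category.assoc _ _ _)
      exact (congrArg (· ≫ chart ρ 1) (Bir.maxHom_ι (ρ g) (ρ g)⁻¹ rfl)).symm

end Construction

/-! ### Varieties and Property FW -/

/-- The morphism `p : Y ⟶ S` makes `Y` a variety over `S` (the spectrum of a field): it is
separated and locally of finite type, and `Y` is noetherian. -/
structure IsVariety {Y S : Scheme.{u}} (p : Y ⟶ S) : Prop where
  locallyOfFiniteType : LocallyOfFiniteType p
  isSeparated : IsSeparated p
  isNoetherian : IsNoetherian Y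

/-- Property FW: in every `G`-set, every commensurated subset (`A` such that `A ∖ g⁻¹A` is finite
for all `g`) is transfixed, that is, has finite symmetric difference with a `G`-invariant subset. -/
def PropertyFW (G : Type u) [Group G] : Prop :=
  ∀ (E : Type u) [MulAction G E] (A : Set E), (∀ g : G, {x ∈ A | g • x ∉ A}.Finite) →
    ∃ B : Set E, (∀ g : G, ∀ x ∈ B, g • x ∈ B) ∧ (symmDiff A B).Finite

end

end BirAction

/-!
A universal globalization exists by gluing copies of `X` indexed by `G`: this is `BirAction.compl`.
The rest uses only that `Z` is locally of finite type over the field, that `G` acts on it, and that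
`X` is a dense open variety in `Z` whose translates cover `Z`.

*A noetherian invariant open set.* Measure points of `Z` by their codimension (the coheight in the
specialization order); it is `G`-invariant, strictly increasing under proper specialization, and
bounded, because algebras of finite type over a field have finite Krull dimension. Suppose that the
points of codimension `< n` in an open set `U`, contained in finitely many translates of `X`, form a
`G`-stable set. Then the points of codimension `n` in `U ∖ g⁻¹U` are generic points of irreducible
components of this noetherian space, so there are finitely many of them: the codimension `n` points
of `U` are a commensurated subset of `Z`. Property FW makes this subset invariant up to a finite
set, and the finite error is repaired by removing the closures of finitely many points from `U` and
adding finitely many translates of what is left. So `n` can be raised until `U` itself is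
`G`-stable (`exists_open_stable_below`).

*Separatedness.* Now `U` lies in a finite union of translates `f • X`, with `f ∈ F`. Let `V` be the
intersection of `U` with all of these, which is nonempty because `Z` is irreducible. Given points
`x ∈ V` and `y ∈ U`, some `f • X` contains both. By translation, any two points of the invariant
open set `⋃ g, g • V` lie in a common translate of `X` (`exists_invariant_open`), and a scheme in
which any two points lie in a common separated open subscheme is separated
(`isSeparated_of_forall_exists_opens`).
-/

open CategoryTheory AlgebraicGeometry TopologicalSpace Pointwise

namespace BirAction

/-- If `n` is a lower bound of the codimension function `c` on `C`, the points where `c` equals `n`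
are generic points of irreducible components of `C`. -/
theorem finite_setOf_eq_of_forall_le {Z : Type*} [TopologicalSpace Z] [QuasiSober Z] {c : Z → ℕ}
    (hc : ∀ x y, x ⤳ y → x ≠ y → c x < c y) {C : Set Z} (hC : IsLocallyClosed C)
    [NoetherianSpace C] {n : ℕ} (hn : ∀ z ∈ C, n ≤ c z) : {z ∈ C | c z = n}.Finite := by
  obtain ⟨S, hS, -, hirr, hcov⟩ :=
    NoetherianSpace.exists_finite_set_isClosed_irreducible (α := C) isClosed_univ
  refine (hS.biUnion (t := fun t => {z : Z | c z = n ∧ z ∈ ((↑) '' t : Set Z)})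
    fun t ht => Set.Subsingleton.finite ?_).subset fun z hz => ?_
  · have h := (hirr t ht).image Subtype.val continuous_subtype_val.continuousOn
    obtain ⟨s, hs⟩ := QuasiSober.sober h.closure isClosed_closure
    have hspec : ∀ z ∈ ((↑) '' t : Set Z), s ⤳ z := fun z hz => hs.specializes (subset_closure hz)
    have hsC : s ∈ C := by
      obtain ⟨U, F, hU, hF, rfl⟩ := hC
      refine ⟨?_, closure_minimal ?_ hF hs.mem⟩
      · obtain ⟨z, hz⟩ := h.1
        obtain ⟨w, -, rfl⟩ := id hz
        exact (hspec _ hz).mem_open hU w.2.1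
      · rintro _ ⟨z, -, rfl⟩
        exact z.2.2
    have key : ∀ z, c z = n ∧ z ∈ ((↑) '' t : Set Z) → s = z := fun z hz => by
      by_contra hne
      exact absurd (hc s z (hspec z hz.2) hne) (by rw [hz.1]; exact not_lt.2 (hn s hsC))
    exact fun z hz w hw => (key z hz).symm.trans (key w hw)
  · obtain ⟨t, ht, hzt⟩ : (⟨z, hz.1⟩ : C) ∈ ⋃₀ S := hcov ▸ Set.mem_univ _
    exact Set.mem_biUnion ht ⟨hz.2, ⟨z, hz.1⟩, hzt, rfl⟩

section Action

variable {G Z : Type u} [Group G] [TopologicalSpace Z] [MulAction G Z] [ContinuousConstSMul G Z]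

theorem noetherianSpace_biUnion_smul {X : Set Z} [NoetherianSpace X] {F : Set G} (hF : F.Finite) :
    NoetherianSpace (⋃ g ∈ F, g • X : Set Z) := by
  have := hF.to_subtype
  have (g : F) : NoetherianSpace (g.1 • X : Set Z) := by
    have h := NoetherianSpace.range (fun x : X => g.1 • (x : Z)) (by fun_prop)
    rwa [Set.range_comp' (g.1 • ·), Subtype.range_coe, Set.image_smul] at h
  rw [Set.biUnion_eq_iUnion]
  exact NoetherianSpace.iUnion fun g : F => (g.1 • X : Set Z)

/-- By induction on `m`, a nonempty open set covered by finitely many translates of `X`, whose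
points of small codimension form a `G`-stable set. The codimension is counted from that of the generic point
only because `c` is not assumed to vanish there. -/
theorem exists_open_stable_below (hG : PropertyFW G) [QuasiSober Z] [IrreducibleSpace Z]
    {c : Z → ℕ} (hinv : ∀ (g : G) z, c (g • z) = c z) (hc : ∀ x y, x ⤳ y → x ≠ y → c x < c y)
    {X : Set Z} (hX : IsOpen X) (hne : X.Nonempty) [NoetherianSpace X] (m : ℕ) :
    ∃ U : Set Z, IsOpen U ∧ U.Nonempty ∧ (∃ F : Set G, F.Finite ∧ U ⊆ ⋃ g ∈ F, g • X) ∧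
      ∀ z ∈ U, c z < c (genericPoint Z) + 1 + m → ∀ g : G, g • z ∈ U := by
  set η := genericPoint Z
  have hgen : ∀ z, η ⤳ z := genericPoint_specializes
  induction m with
  | zero =>
    -- the generic point is the only point of its codimension, hence it is fixed by `G`
    have hfix : ∀ z, c z ≤ c η → z = η := fun z hz => by
      by_contra h
      exact absurd (hc η z (hgen z) (Ne.symm h)) (not_lt.2 hz)
    refine ⟨X, hX, hne, ⟨{1}, Set.finite_singleton 1, by simp⟩, fun z hz hzc g => ?_⟩
    have hz' : z = η := hfix z (by omega)
    rw [hfix (g • z) (by rw [hinv, hz']), ← hz']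
    exact hz
  | succ m ih =>
    obtain ⟨U, hU, hUne, ⟨F, hF, hUF⟩, hst⟩ := ih
    set n := c η + 1 + m with hn
    have := noetherianSpace_biUnion_smul (X := X) hF
    -- Property FW for the codimension `n` points of `U`, a commensurated subset of `Z`
    obtain ⟨B, hB, hAB⟩ := hG Z {z ∈ U | c z = n} (fun g => by
      set C : Set Z := U ∩ ((fun z => g • z) ⁻¹' U)ᶜ
      have hC : IsLocallyClosed C :=
        ⟨U, _, hU, (hU.preimage (continuous_const_smul g)).isClosed_compl, rfl⟩
      have : NoetherianSpace C := NoetherianSpace.of_subset (Set.inter_subset_left.trans hUF)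
      refine (finite_setOf_eq_of_forall_le hc hC (n := n) fun z hz => ?_).subset ?_
      · by_contra hlt
        exact hz.2 (hst z hz.1 (not_le.1 hlt) g)
      · rintro z ⟨⟨hz, hzn⟩, hg⟩
        exact ⟨⟨hz, fun h => hg ⟨h, (hinv g z).trans hzn⟩⟩, hzn⟩)
    set D : Set Z := {z ∈ U | c z = n} \ B
    have hDfin : D.Finite := hAB.subset fun z hz => Or.inl hz
    -- removing the closure of `D` leaves all points of codimension `< n` and, in codimension `n`,
    -- exactly the points of `U ∩ B`
    set U' : Set Z := U \ ⋃ a ∈ D, closure {a}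
    have hU'open : IsOpen U' := hU.sdiff (hDfin.isClosed_biUnion fun _ _ => isClosed_closure)
    have hlow : ∀ z ∈ U, c z < n → z ∈ U' := fun z hz hzn => by
      refine ⟨hz, fun hmem => ?_⟩
      obtain ⟨a, ha, hza⟩ := Set.mem_iUnion₂.1 hmem
      have hs : a ⤳ z := specializes_iff_mem_closure.2 hza
      have han : c a = n := ha.1.2
      have := hc a z hs (by rintro rfl; omega)
      omega
    have hη' : η ∈ U' := by
      obtain ⟨z, hz⟩ := hUne
      exact hlow η ((hgen z).mem_open hU hz) (by omega)
    have hmemB : ∀ z ∈ U', c z = n → z ∈ B := fun z hz hzn => by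
      by_contra hzB
      exact hz.2 (Set.mem_iUnion₂.2 ⟨z, ⟨⟨hz.1, hzn⟩, hzB⟩, subset_closure rfl⟩)
    have hmemU' : ∀ z ∈ U, c z = n → z ∈ B → z ∈ U' := fun z hz hzn hzB => by
      refine ⟨hz, fun hmem => ?_⟩
      obtain ⟨a, ha, hza⟩ := Set.mem_iUnion₂.1 hmem
      have hs : a ⤳ z := specializes_iff_mem_closure.2 hza
      have han : c a = n := ha.1.2
      by_cases hne : a = z
      · exact ha.2 (hne ▸ hzB)
      · have := hc a z hs hne
        omega
    -- the codimension `n` points of the union of all translates of `U'` lie in `B`; all but finitely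
    -- many points of `B` are codimension `n` points of `U`, and one translate of `U'` is added for
    -- each of the exceptional ones that lie in that union
    set E : Set Z := B \ {z ∈ U | c z = n}
    have hEfin : E.Finite := hAB.subset fun z hz => Or.inr hz
    have hpick : ∀ b : Z, ∃ g : G, (∃ h : G, b ∈ h • U') → b ∈ g • U' := fun b => by
      by_cases h : ∃ h : G, b ∈ h • U'
      · exact ⟨h.choose, fun _ => h.choose_spec⟩
      · exact ⟨1, fun h' => absurd h' h⟩
    choose p hp using hpick
    set P : Set G := insert 1 (p '' E)
    have hPfin : P.Finite := (hEfin.image p).insert 1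
    refine ⟨⋃ g ∈ P, g • U', isOpen_biUnion fun g _ => hU'open.smul g,
      ⟨η, Set.mem_biUnion (Set.mem_insert _ _) (by rwa [one_smul])⟩,
      ⟨P * F, hPfin.mul hF, ?_⟩, fun z hz hzc g => ?_⟩
    · refine Set.iUnion₂_subset fun g hg => ?_
      rintro _ ⟨z, hz, rfl⟩
      obtain ⟨h, hh, hzh⟩ := Set.mem_iUnion₂.1 (hUF hz.1)
      refine Set.mem_biUnion (Set.mul_mem_mul hg hh) ?_
      rw [mul_smul]
      exact Set.smul_mem_smul_set hzh
    · obtain ⟨h, hh, y, hy, rfl⟩ := Set.mem_iUnion₂.1 hz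
      simp only [hinv] at hzc ⊢
      have hone : ∀ w ∈ U', w ∈ ⋃ g ∈ P, g • U' := fun w hw =>
        Set.mem_biUnion (Set.mem_insert _ _) (by rwa [one_smul])
      rw [smul_smul]
      rcases (Nat.lt_succ_iff.1 hzc).lt_or_eq with hlt | heq
      · exact hone _ (hlow _ (hst y hy.1 hlt (g * h)) (by rwa [hinv]))
      · have hyB : (g * h) • y ∈ B := hB _ _ (hmemB y hy heq)
        by_cases hyU : (g * h) • y ∈ U
        · exact hone _ (hmemU' _ hyU (by rwa [hinv]) hyB)
        · exact Set.mem_biUnion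
            (Set.mem_insert_of_mem _ ⟨(g * h) • y, ⟨hyB, fun h' => hyU h'.1⟩, rfl⟩)
            (hp _ ⟨g * h, y, hy, rfl⟩)

/-- The set obtained is a union of translates of the locus of a `G`-stable open set that lies in
every member of a finite cover by translates of `X`; this is why two of its points always lie in a common
translate. -/
theorem exists_invariant_open (hG : PropertyFW G) [QuasiSober Z] [IrreducibleSpace Z]
    {c : Z → ℕ} (hinv : ∀ (g : G) z, c (g • z) = c z) (hc : ∀ x y, x ⤳ y → x ≠ y → c x < c y)
    {N : ℕ} (hN : ∀ z, c z ≤ N)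
    {X : Set Z} (hX : IsOpen X) (hne : X.Nonempty) [NoetherianSpace X] :
    ∃ U : Set Z, IsOpen U ∧ U.Nonempty ∧ (∀ g : G, ∀ z ∈ U, g • z ∈ U) ∧
      NoetherianSpace U ∧
      ∀ x ∈ U, ∀ y ∈ U, ∃ g : G, x ∈ g • X ∧ y ∈ g • X := by
  obtain ⟨U, hU, hUne, ⟨F, hF, hUF⟩, hst⟩ := exists_open_stable_below hG hinv hc hX hne N
  have hst' : ∀ z ∈ U, ∀ g : G, g • z ∈ U := fun z hz g =>
    hst z hz (by have := hN z; omega) g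
  have := noetherianSpace_biUnion_smul (X := X) hF
  set V : Set Z := U ∩ ⋂ g ∈ F, g • X
  have hVo : IsOpen V := hU.inter (hF.isOpen_biInter fun g _ => hX.smul g)
  have hVne : V.Nonempty := by
    have hgen : ∀ W : Set Z, IsOpen W → W.Nonempty → genericPoint Z ∈ W := fun W hW ⟨z, hz⟩ =>
      (genericPoint_specializes z).mem_open hW hz
    exact ⟨genericPoint Z, hgen U hU hUne, Set.mem_iInter₂.2 fun g _ =>
      hgen _ (hX.smul g) hne.smul_set⟩
  refine ⟨⋃ g : G, g • V, isOpen_iUnion fun g => hVo.smul g, ?_, ?_, ?_, ?_⟩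
  · obtain ⟨z, hz⟩ := hVne
    exact ⟨z, Set.mem_iUnion.2 ⟨1, by rwa [one_smul]⟩⟩
  · rintro g _ ⟨_, ⟨h, rfl⟩, z, hz, rfl⟩
    exact Set.mem_iUnion.2 ⟨g * h, z, hz, mul_smul g h z⟩
  · refine NoetherianSpace.of_subset (W := ⋃ g ∈ F, g • X) (Set.iUnion_subset fun g => ?_)
    rintro _ ⟨z, hz, rfl⟩
    exact hUF (hst' z hz.1 g)
  · rintro _ ⟨_, ⟨g, rfl⟩, x, hx, rfl⟩ _ ⟨_, ⟨h, rfl⟩, y, hy, rfl⟩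
    obtain ⟨f, hf, hyf⟩ := Set.mem_iUnion₂.1 (hUF (hst' y hy.1 (g⁻¹ * h)))
    refine ⟨g * f, ?_, ?_⟩
    · simp only [mul_smul]
      exact Set.smul_mem_smul_set (Set.mem_iInter₂.1 hx.2 f hf)
    · have := Set.smul_mem_smul_set (a := g) hyf
      rwa [smul_smul g (g⁻¹ * h) y, mul_inv_cancel_left, ← mul_smul] at this

end Action

theorem exists_ringKrullDim_le_of_finiteType (k A : Type*) [Field k] [CommRing A] [Algebra k A]
    [h : Algebra.FiniteType k A] : ∃ n : ℕ, ringKrullDim A ≤ n := by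
  obtain ⟨n, f, hf⟩ := Algebra.FiniteType.iff_quotient_mvPolynomial''.1 h
  refine ⟨n, (ringKrullDim_le_of_surjective f.toRingHom hf).trans_eq ?_⟩
  rw [MvPolynomial.ringKrullDim_of_isNoetherianRing, ringKrullDim_eq_zero_of_field, zero_add,
    Nat.card_fin]

theorem exists_coheight_le {k : Type u} [Field k] {X : Scheme.{u}} [CompactSpace X]
    (p : X ⟶ Spec (CommRingCat.of k)) [LocallyOfFiniteType p] :
    ∃ N : ℕ, ∀ x : X, Order.coheight x ≤ N := by
  have aff : ∀ (R : CommRingCat.{u}) (f : Spec R ⟶ X) [IsOpenImmersion f],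
      ∃ N : ℕ, ∀ y : Spec R, Order.coheight (f y) ≤ N := fun R f _ => by
    obtain ⟨φ, hφ⟩ := Spec.map_surjective (f ≫ p)
    have h : LocallyOfFiniteType (Spec.map φ) := hφ ▸ inferInstance
    have hft : φ.hom.FiniteType := HasRingHomProperty.Spec_iff.mp h
    algebraize [φ.hom]
    obtain ⟨n, hn⟩ := exists_ringKrullDim_le_of_finiteType k R
    refine ⟨n, fun y => ?_⟩
    have : (PrimeSpectrum.asIdeal y).IsPrime := PrimeSpectrum.isPrime y
    have hy := (Ideal.height_le_ringKrullDim_of_isPrime (I := PrimeSpectrum.asIdeal y)).trans hn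
    refine (coheight_eq_of_isOpenImmersion f).trans_le ?_
    rw [← idealHeight_eq_coheight]
    exact_mod_cast hy
  have nhds (x : X) := Scheme.exists_affine_mem_range_and_range_subset (U := ⊤) (x := x) trivial
  choose R f hf hx using nhds
  choose N hN using fun x => aff (R x) (f x)
  obtain ⟨t, ht⟩ := isCompact_univ.elim_finite_subcover (fun x => ((f x).opensRange : Set X))
    (fun x => (f x).opensRange.isOpen) fun x _ => Set.mem_iUnion.2 ⟨x, (hx x).1⟩
  refine ⟨t.sup N, fun x => ?_⟩
  obtain ⟨i, hi, y, rfl⟩ := Set.mem_iUnion₂.1 (ht (Set.mem_univ x))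
  exact (hN i y).trans (Nat.cast_le.2 (Finset.le_sup hi))

/-- By the valuative criterion: a morphism from the spectrum of a valuation ring factors through
every open set containing the image of the closed point. -/
theorem isSeparated_of_forall_exists_opens {Y S : Scheme.{u}} (f : Y ⟶ S) [QuasiSeparated f]
    (h : ∀ x y : Y, ∃ W : Y.Opens, x ∈ W ∧ y ∈ W ∧ IsSeparated (W.ι ≫ f)) : IsSeparated f := by
  refine IsSeparated.of_valuativeCriterion f fun S => ⟨?_⟩
  rintro ⟨l, hl, hl'⟩ ⟨m, hm, hm'⟩
  obtain ⟨W, hx, hy, hW⟩ := h (l (IsLocalRing.closedPoint S.R)) (m (IsLocalRing.closedPoint S.R))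
  have hfac : ∀ a : Spec (.of S.R) ⟶ Y, a (IsLocalRing.closedPoint S.R) ∈ W →
      ∃ a' : Spec (.of S.R) ⟶ W, a' ≫ W.ι = a := fun a ha => by
    refine ⟨_, IsOpenImmersion.lift_fac W.ι a ?_⟩
    rintro _ ⟨t, rfl⟩
    rw [Scheme.Opens.range_ι]
    exact ((IsLocalRing.specializes_closedPoint t).map a.continuous).mem_open W.isOpen ha
  obtain ⟨l, rfl⟩ := hfac l hx
  obtain ⟨m, rfl⟩ := hfac m hy
  have hlm : Spec.map (CommRingCat.ofHom (algebraMap S.R S.K)) ≫ l =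
      Spec.map (CommRingCat.ofHom (algebraMap S.R S.K)) ≫ m := by
    rw [← cancel_mono W.ι, Category.assoc, Category.assoc, hl, hm]
  let T : ValuativeCommSq (W.ι ≫ f) :=
    { R := S.R, K := S.K, i₁ := Spec.map (CommRingCat.ofHom (algebraMap S.R S.K)) ≫ l, i₂ := S.i₂
      commSq := ⟨by rw [← hl', Category.assoc, Category.assoc]⟩ }
  have := IsSeparated.valuativeCriterion (W.ι ≫ f) T
  have key := this.elim ⟨l, rfl, (Category.assoc _ _ _).symm.trans hl'⟩
    ⟨m, hlm.symm, (Category.assoc _ _ _).symm.trans hm'⟩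
  ext1
  exact congrArg (· ≫ W.ι) (congrArg CommSq.LiftStruct.l key)

/-- The action need only be given on the ambient scheme: the birational action that it induces on
`X` plays no role. -/
theorem exists_invariant_isVariety {k : Type u} [Field k] {X Z : Scheme.{u}} [IrreducibleSpace X]
    {p : X ⟶ Spec (CommRingCat.of k)} (hX : IsVariety p)
    {G : Type u} [Group G] (hG : PropertyFW G)
    (s : Z ⟶ Spec (CommRingCat.of k)) [LocallyOfFiniteType s] (act : G →* Aut Z)
    (hact : ∀ g, (act g).hom ≫ s = s) (i : X ⟶ Z) [IsOpenImmersion i] (hi : i ≫ s = p)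
    (hd : DenseRange i) (horb : ∀ z, ∃ (g : G) (x : X), (act g).hom (i x) = z) :
    ∃ U : Z.Opens, Dense (U : Set Z) ∧ (∀ g : G, (act g).hom ⁻¹ᵁ U = U) ∧
      IsVariety (U.ι ≫ s) := by
  have := hX.isNoetherian
  have := hX.isSeparated
  have := hX.locallyOfFiniteType
  let A : MulAction G Z :=
    { smul g z := (act g).hom z
      one_smul z := by
        change (act 1).hom z = z
        rw [map_one]
        rfl
      mul_smul g h z := by
        change (act (g * h)).hom z = (act g).hom ((act h).hom z)
        rw [map_mul, ← Scheme.Hom.comp_apply]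
        rfl }
  have hsmul : ∀ (g : G) (z : Z), g • z = (act g).hom z := fun _ _ => rfl
  have : ContinuousConstSMul G Z := ⟨fun g => (act g).hom.continuous⟩
  have : IrreducibleSpace Z := by
    have h := (IrreducibleSpace.isIrreducible_univ X).image i i.continuous.continuousOn
    rw [Set.image_univ, ← isIrreducible_iff_closure, hd.closure_range] at h
    exact (irreducibleSpace_def Z).2 h
  obtain ⟨N, hN⟩ := exists_coheight_le p
  have hinv : ∀ (g : G) (z : Z), Order.coheight (g • z) = Order.coheight z := fun g z =>
    have : IsIso (act g).hom := (act g).isIso_hom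
    coheight_eq_of_isOpenImmersion (act g).hom
  have hN' : ∀ z : Z, Order.coheight z ≤ N := fun z => by
    obtain ⟨g, x, rfl⟩ := horb z
    refine (hinv g (i x)).trans_le ((coheight_eq_of_isOpenImmersion i).trans_le (hN x))
  have hne : ∀ z : Z, Order.coheight z ≠ ⊤ := fun z =>
    ((hN' z).trans_lt (ENat.natCast_lt_top N)).ne
  have hnoeth : NoetherianSpace (Set.range i) := NoetherianSpace.range i i.continuous
  obtain ⟨U, hU, hUne, hUinv, hUN, hpair⟩ := exists_invariant_open hG (Z := Z)
    (c := fun z => (Order.coheight z).toNat) (fun g z => congrArg _ (hinv g z))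
    (fun x y hxy hne' => by
      have hlt : y < x := lt_of_le_not_ge hxy fun h => hne' (hxy.antisymm h).eq
      have := Order.coheight_strictAnti hlt (hne x).lt_top
      exact ENat.natCast_lt_natCast.1 (by
        rwa [ENat.natCast_toNat (hne x), ENat.natCast_toNat (hne y)]))
    (N := N) (fun z => ENat.toNat_le_of_le_natCast (hN' z))
    (X := Set.range i) i.opensRange.isOpen (Set.range_nonempty i)
  let O : Z.Opens := ⟨U, hU⟩
  have hlf : LocallyOfFiniteType (O.ι ≫ s) := inferInstance
  have hln : IsLocallyNoetherian O := LocallyOfFiniteType.isLocallyNoetherian (O.ι ≫ s)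
  have hc : CompactSpace O := inferInstanceAs (CompactSpace U)
  refine ⟨O, hU.dense hUne, fun g => ?_, hlf, ?_, ⟨⟩⟩
  · ext z
    refine ⟨fun h => ?_, fun h => hUinv g z h⟩
    have := hUinv g⁻¹ _ h
    rwa [← hsmul, inv_smul_smul] at this
  · refine isSeparated_of_forall_exists_opens _ fun x y => ?_
    obtain ⟨g, hx, hy⟩ := hpair x.1 x.2 y.1 y.2
    -- translation by `g⁻¹` identifies `O ∩ gX` with an open subscheme of the separated scheme `X`
    let W : O.toScheme.Opens := (O.ι ≫ (act g⁻¹).hom) ⁻¹ᵁ i.opensRange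
    refine ⟨W, Set.mem_smul_set_iff_inv_smul_mem.1 hx, Set.mem_smul_set_iff_inv_smul_mem.1 hy, ?_⟩
    let l : W.toScheme ⟶ X := IsOpenImmersion.lift i (W.ι ≫ O.ι ≫ (act g⁻¹).hom) (by
      rintro _ ⟨w, rfl⟩
      exact w.2)
    have hl : l ≫ i = W.ι ≫ O.ι ≫ (act g⁻¹).hom := IsOpenImmersion.lift_fac _ _ _
    have : IsIso (act g⁻¹).hom := (act g⁻¹).isIso_hom
    have : Mono (l ≫ i) := hl ▸ inferInstance
    have : Mono l := mono_of_mono l i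
    have hlp : W.ι ≫ O.ι ≫ s = l ≫ p := by
      rw [← hi, reassoc_of% hl, hact]
    rw [hlp]
    infer_instance

end BirAction

theorem theorem2 {k : Type u} [Field k] (X : Scheme.{u}) [X.Over (Spec (CommRingCat.of k))]
    [IrreducibleSpace X] (hX : BirAction.IsVariety (X ↘ Spec (CommRingCat.of k)))
    {G : Type u} [Group G] (hG : BirAction.PropertyFW G)
    (ρ : G →* BirAction.Bir (Spec (CommRingCat.of k)) X) :
    (BirAction.NoEmbeddedPoints X → Nonempty (BirAction.UniversalGlobalization ρ)) ∧
      ∀ Z : BirAction.UniversalGlobalization ρ, ∃ U : Z.space.Opens,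
        Dense (U : Set Z.space) ∧ (∀ g : G, (Z.act g).hom ⁻¹ᵁ U = U) ∧
          BirAction.IsVariety (U.ι ≫ Z.str) := by
  have := hX.isNoetherian
  have := hX.isSeparated
  have := hX.locallyOfFiniteType
  refine ⟨fun _ => ⟨BirAction.compl ρ⟩, fun Z => ?_⟩
  have := Z.locallyOfFiniteType
  have := Z.isOpenImmersion
  exact BirAction.exists_invariant_isVariety hX hG Z.str Z.act Z.act_str Z.incl Z.incl_str
    Z.denseRange Z.exists_act_incl
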